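/- Let $(X,m)$ be a Lebesgue space (a complete probability space isomorphic mod $0$, via some map $\varphi:X\to\mathbb R$, to the completion of a Borel probability measure on $\mathbb R$), and let a countable group $G$ act on $X$ by measurable transformations preserving the measure class of $m$. Let $\mathcal I$ be the $\sigma$-algebra of measurable $G$-invariant sets, and for $x\in X$ let $m_x$ be the conditional probability measure of $m$ with respect to $\mathcal I$ at $x$ (the ergodic component through $x$; formally, the regular conditional distribution of $\varphi$ given $\mathcal I$, for any fixed $\varphi$ as above). Let - $\mathcal C$ (the continual part) be the set of $x$ such that $m_x$ is purely non-atomic, - $\mathcal D$ (the discontinual part) be the set of $x$ such that $m_x$ is purely atomic, i.e. carried by a countable set, - $\mathcal D_{\rm free}$ be the set of $x\in\mathcal D$ whose stabilizer in $G$ is trivial. A measurable set $A\subset X$ is called recurrent if for a.e. $x\in A$ there is $g\in G\setminus\{e\}$ with $gx\in A$, and wandering if its translates $gA$, $g\in G$, are pairwise disjoint. The action on an invariant measurable set $Y$ is conservative if every measurable subset of $Y$ is recurrent, and completely dissipative if $Y$ coincides mod $0$ with the union of the translates of a wandering set $A\subset Y$. Theorem (Hopf decomposition for general actions). The sets $\mathcal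 C$, $\mathcal D$ and $\mathcal D_{\rm free}$ are measurable and $G$-invariant, $\mathcal C\cap\mathcal D=\varnothing$ and $\mathcal C\cup\mathcal D=X$ mod $0$. Consequently $X$ is, mod $0$, the disjoint union of two $G$-invariant measurable sets $$X=[\mathcal C\cup(\mathcal D\setminus\mathcal D_{\rm free})]\sqcup\mathcal D_{\rm free},$$ and the action on $\mathcal C\cup(\mathcal D\setminus\mathcal D_{\rm free})$ is conservative, while the action on $\mathcal D_{\rm free}$ is completely dissipative. -/

import Mathlib

open MeasureTheory ProbabilityTheory Set
open scoped Pointwise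

namespace HopfDecomposition

noncomputable section

/-- `φ` is an isomorphism mod 0 of the measure space `(X, m)` onto the real line endowed with the
(completion of the) Borel measure `φ_* m`: it is measurable, and off a null set it is injective and
maps measurable sets to measurable sets of the completion. A complete probability space is a
Lebesgue space if and only if it admits such a `φ`. -/
structure IsLebesgueCoordinate {X : Type*} [MeasurableSpace X] (m : Measure X) (φ : X → ℝ) :
    Prop where
  measurable : Measurable φ
  exists_conull : ∃ X₀ : Set X, m X₀ᶜ = 0 ∧ InjOn φ X₀ ∧
    ∀ A ⊆ X₀, MeasurableSet A → NullMeasurableSet (φ '' A) (m.map φ)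

/-- The σ-algebra of measurable `G`-invariant subsets of `X`. -/
@[reducible] def invariantSets (G X : Type*) [Group G] [MulAction G X] [MeasurableSpace X] :
    MeasurableSpace X :=
  ⨅ g : G, MeasurableSpace.invariants (fun x : X => g • x)

/-- The system of conditional measures of `m` with respect to the σ-algebra of invariant sets,
i.e. the ergodic components of the action: `ergodicComponent G m φ x` is the conditional
probability measure `m_x` on the ergodic component through `x`, written in the coordinate `φ`.
It is the regular conditional distribution of `φ` given the invariant sets. (On a complete
σ-algebra the conditional measures are only defined on a countably generated sub-σ-algebra that
depends on a choice of coordinate, here the one generated by `φ`.) -/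
def ergodicComponent (G : Type*) {X : Type*} [Group G] [MulAction G X] [MeasurableSpace X]
    (m : Measure X) [IsFiniteMeasure m] (φ : X → ℝ) (x : X) : Measure ℝ :=
  @condDistrib X X ℝ _ _ _ _ (invariantSets G X) φ id m _ x

/-- A measure without atoms. -/
def IsPurelyNonAtomic (ν : Measure ℝ) : Prop := ∀ t : ℝ, ν {t} = 0

/-- A measure carried by a countable set of points. -/
def IsPurelyAtomic (ν : Measure ℝ) : Prop := ∃ S : Set ℝ, S.Countable ∧ ν Sᶜ = 0

section Parts

variable (G : Type*) {X : Type*} [Group G] [MulAction G X] [MeasurableSpace X]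
  (m : Measure X) [IsFiniteMeasure m] (φ : X → ℝ)

/-- The continual part: the union of the purely non-atomic ergodic components. -/
def continualPart : Set X := {x | IsPurelyNonAtomic (ergodicComponent G m φ x)}

/-- The discontinual part: the union of the purely atomic ergodic components. -/
def discontinualPart : Set X := {x | IsPurelyAtomic (ergodicComponent G m φ x)}

/-- The union of the free orbits contained in the discontinual part. -/
def freeDiscontinualPart : Set X :=
  {x | x ∈ discontinualPart G m φ ∧ MulAction.stabilizer G x = ⊥}

end Parts

section Recurrence

variable (G : Type*) {X : Type*} [Group G] [MulAction G X] [MeasurableSpace X] (m : Measure X)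

/-- A measurable set `A` such that a.e. point of `A` returns to `A` under some `g ≠ 1`. -/
def IsRecurrentSet (A : Set X) : Prop :=
  MeasurableSet A ∧ ∀ᵐ x ∂m, x ∈ A → ∃ g : G, g ≠ 1 ∧ g • x ∈ A

/-- A measurable set `A` whose translates `g • A`, `g ∈ G`, are pairwise disjoint. -/
def IsWanderingSet (A : Set X) : Prop :=
  MeasurableSet A ∧ Pairwise fun g h : G => Disjoint (g • A) (h • A)

/-- The restriction of the action to the invariant set `Y` is conservative: every measurable
subset of `Y` is recurrent. -/
def IsConservativeOn (Y : Set X) : Prop :=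
  ∀ A ⊆ Y, MeasurableSet A → IsRecurrentSet G m A

/-- The restriction of the action to the invariant set `Y` is completely dissipative: `Y` is, up
to a null set, the union of the translates of a wandering set. -/
def IsCompletelyDissipativeOn (Y : Set X) : Prop :=
  ∃ A ⊆ Y, IsWanderingSet G A ∧ (⋃ g : G, g • A) =ᵐ[m] Y

/-- A measurable `G`-invariant set. -/
def IsInvariantMeasurable (Y : Set X) : Prop :=
  MeasurableSet Y ∧ ∀ g : G, g • Y = Y

end Recurrence

end

end HopfDecomposition

namespace HopfDecomposition

/-! ### Atoms of a finite kernel, selected measurably. -/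

section Kernel

variable {Z : Type*} [MeasurableSpace Z] (κ : Kernel Z ℝ)

/-! Disintegrate the joint law of `(p, φ)`, with `p` the factor onto invariant sets. By Fubini, a
set of pairs is null iff almost all its fibres are null. A measurable graph `φ = h ∘ p` has
one-point fibres, so almost every point on it is an atom of its component, while conversely the
atoms are covered by countably many graphs, the rational quantiles. Hence translates of atoms again
lie on graphs over the factor, being an atom is invariant mod 0, and almost every component is
purely atomic or purely non-atomic.

If no point of `W` returns, each orbit meets `W` at most once, so on `W` the coordinate is a
function of the invariants: `W` lies on a graph and is null over non-atomic components. A point with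
nontrivial stabilizer returns to itself. On free atomic components, picking one atom per component
measurably gives a wandering set whose translates fill the component. -/

theorem measurable_kernel_singleton [IsSFiniteKernel κ] :
    Measurable fun p : Z × ℝ => κ p.1 {p.2} := by
  have hs : MeasurableSet {q : (Z × ℝ) × ℝ | q.2 = q.1.2} :=
    measurableSet_eq_fun measurable_snd (measurable_snd.comp measurable_fst)
  have h := Kernel.measurable_kernel_prodMk_left (κ := κ.comap Prod.fst measurable_fst) hs
  simpa [Kernel.comap_apply, preimage] using h

/-- The pairs `(z, t)` such that `t` is an atom of `κ z`. -/
def atomSet : Set (Z × ℝ) := {p | κ p.1 {p.2} ≠ 0}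

theorem measurableSet_atomSet [IsSFiniteKernel κ] : MeasurableSet (atomSet κ) :=
  (measurable_kernel_singleton κ) (measurableSet_singleton 0).compl

theorem countable_atoms [IsFiniteKernel κ] (z : Z) : {t | κ z {t} ≠ 0}.Countable := by
  have h := Measure.countable_meas_pos_of_disjoint_iUnion (μ := κ z) (As := fun t : ℝ => {t})
    (fun t => measurableSet_singleton t)
    (fun s t hst => by simpa using hst)
  simpa [pos_iff_ne_zero] using h

theorem isPurelyNonAtomic_iff [IsFiniteKernel κ] (z : Z) :
    IsPurelyNonAtomic (κ z) ↔ κ z (Prod.mk z ⁻¹' atomSet κ) = 0 := by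
  constructor
  · intro h
    have : Prod.mk z ⁻¹' atomSet κ = ∅ := by
      ext t; simpa [atomSet] using h t
    simp [this]
  · intro h t
    by_contra ht
    exact ht (measure_mono_null (by rintro _ rfl; exact ht) h)

theorem isPurelyAtomic_iff [IsFiniteKernel κ] (z : Z) :
    IsPurelyAtomic (κ z) ↔ κ z (Prod.mk z ⁻¹' (atomSet κ)ᶜ) = 0 := by
  constructor
  · rintro ⟨S, hS, h⟩
    have h2 : κ z (S ∩ Prod.mk z ⁻¹' (atomSet κ)ᶜ) = 0 := by
      rw [← biUnion_of_singleton (S ∩ _), measure_biUnion_null_iff (hS.mono inter_subset_left)]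
      rintro t ⟨-, ht⟩
      simpa [atomSet] using ht
    refine measure_mono_null ?_ (measure_union_null h h2)
    intro t ht
    by_cases hS' : t ∈ S
    · exact Or.inr ⟨hS', ht⟩
    · exact Or.inl hS'
  · intro h
    exact ⟨_, countable_atoms κ z, h⟩

theorem measurableSet_isPurelyNonAtomic [IsFiniteKernel κ] :
    MeasurableSet {z | IsPurelyNonAtomic (κ z)} := by
  simp only [isPurelyNonAtomic_iff]
  exact Kernel.measurable_kernel_prodMk_left (measurableSet_atomSet κ) (measurableSet_singleton 0)

theorem measurableSet_isPurelyAtomic [IsFiniteKernel κ] :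
    MeasurableSet {z | IsPurelyAtomic (κ z)} := by
  simp only [isPurelyAtomic_iff]
  exact Kernel.measurable_kernel_prodMk_left (measurableSet_atomSet κ).compl
    (measurableSet_singleton 0)

theorem not_isPurelyAtomic_of_isPurelyNonAtomic {ν : Measure ℝ} [NeZero ν]
    (h : IsPurelyNonAtomic ν) : ¬ IsPurelyAtomic ν := by
  rintro ⟨S, hS, hS'⟩
  have h2 : ν S = 0 := by
    rw [← biUnion_of_singleton S, measure_biUnion_null_iff hS]
    exact fun t _ => h t
  have h3 := measure_union_null h2 hS'
  rw [union_compl_self] at h3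
  exact NeZero.ne ν (Measure.measure_univ_eq_zero.1 h3)

open Classical in
/-- The `c`-quantile of `κ z`. -/
noncomputable def quantile (c : ENNReal) (z : Z) : ℝ :=
  (⨆ r : ℚ, if κ z (Iic (r : ℝ)) < c then ((r : ℝ) : EReal) else ⊥).toReal

theorem measurable_quantile (c : ENNReal) : Measurable (quantile κ c) := by
  refine Measurable.ereal_toReal (Measurable.iSup fun r => ?_)
  refine Measurable.ite ?_ measurable_const measurable_const
  exact measurableSet_lt (κ.measurable_coe measurableSet_Iic) measurable_const

/-- The distribution function jumps at an atom, and any rational level strictly inside the jump has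
that atom as its quantile. Countably many measurable functions thus list all atoms. -/
theorem exists_quantile_eq [IsFiniteKernel κ] {z : Z} {t : ℝ} (ht : κ z {t} ≠ 0) :
    ∃ q : ℚ, quantile κ (Real.toNNReal q) z = t := by
  have hlt : κ z (Iio t) < κ z (Iic t) := by
    have : Iic t = Iio t ∪ {t} := by ext s; simp [le_iff_lt_or_eq]
    rw [this, measure_union (by simp) (measurableSet_singleton t)]
    exact ENNReal.lt_add_right (measure_ne_top _ _) ht
  obtain ⟨q, -, h1, h2⟩ := ENNReal.lt_iff_exists_rat_btwn.1 hlt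
  refine ⟨q, ?_⟩
  have key : (⨆ r : ℚ, if κ z (Iic (r : ℝ)) < (Real.toNNReal q : ENNReal)
      then ((r : ℝ) : EReal) else ⊥) = (t : EReal) := by
    apply le_antisymm
    · refine iSup_le fun r => ?_
      split_ifs with h
      · by_contra hr
        rw [not_le, EReal.coe_lt_coe_iff] at hr
        exact absurd (h.trans h2) (not_lt.2 (measure_mono (Iic_subset_Iic.2 hr.le)))
      · exact bot_le
    · refine le_of_forall_lt fun c hc => ?_
      obtain ⟨r, hr1, hr2⟩ := EReal.lt_iff_exists_rat_btwn.1 hc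
      refine lt_of_lt_of_le hr1 (le_trans ?_ (le_iSup _ r))
      rw [if_pos]
      refine lt_of_le_of_lt (measure_mono ?_) h1
      exact Iic_subset_Iio.2 (by exact_mod_cast hr2)
  simp only [quantile]
  convert EReal.toReal_coe t

theorem exists_measurable_atom [IsFiniteKernel κ] :
    ∃ f : Z → ℝ, Measurable f ∧ ∀ z, ¬ IsPurelyNonAtomic (κ z) → κ z {f z} ≠ 0 := by
  classical
  obtain ⟨e, he⟩ := exists_surjective_nat ℚ
  -- The second alternative makes the search for the first good level terminate on atomless fibres
  -- too.
  let P : ℕ → Z → Prop := fun n z =>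
    κ z {quantile κ (Real.toNNReal (e n)) z} ≠ 0 ∨ IsPurelyNonAtomic (κ z)
  have hP : ∀ z, ∃ n, P n z := by
    intro z
    by_cases h : IsPurelyNonAtomic (κ z)
    · exact ⟨0, Or.inr h⟩
    · obtain ⟨t, ht⟩ := not_forall.1 h
      obtain ⟨q, hq⟩ := exists_quantile_eq κ ht
      obtain ⟨n, rfl⟩ := he q
      exact ⟨n, Or.inl (by rwa [hq])⟩
  refine ⟨fun z => quantile κ (Real.toNNReal (e (Nat.find (hP z)))) z, ?_, fun z hz => ?_⟩
  · refine Measurable.find (f := fun n => quantile κ (Real.toNNReal (e n))) (p := P)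
      (fun n => measurable_quantile κ _) (fun n => ?_) hP
    refine MeasurableSet.union ?_ (measurableSet_isPurelyNonAtomic κ)
    exact (measurable_id.prodMk (measurable_quantile κ (Real.toNNReal (e n)))) (measurableSet_atomSet κ)
  · exact (Nat.find_spec (hP z)).resolve_right hz

end Kernel

/-! ### Fubini for the conditional distribution. -/

section CondDistrib

variable {X Z : Type*} [MeasurableSpace X] [MeasurableSpace Z] {m : Measure X} [IsFiniteMeasure m]
  {φ : X → ℝ} {p : X → Z}

theorem measure_prodMk_mem_eq_lintegral_condDistrib (hφ : Measurable φ) (hp : Measurable p)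
    {B : Set (Z × ℝ)} (hB : MeasurableSet B) :
    m {x | (p x, φ x) ∈ B} = ∫⁻ x, condDistrib φ p m (p x) (Prod.mk (p x) ⁻¹' B) ∂m := by
  have h := congrArg (fun μ : Measure (Z × ℝ) => μ B) (compProd_map_condDistrib (μ := m) (X := p) (Y := φ)
    hφ.aemeasurable)
  simp only [Measure.compProd_apply hB, Measure.map_apply (hp.prodMk hφ) hB] at h
  rw [lintegral_map (Kernel.measurable_kernel_prodMk_left hB) hp] at h
  exact h.symm

/-- A measurable set of pairs is null for the joint law iff almost all of its sections are null. -/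
theorem measure_prodMk_mem_eq_zero_iff (hφ : Measurable φ) (hp : Measurable p)
    {B : Set (Z × ℝ)} (hB : MeasurableSet B) :
    m {x | (p x, φ x) ∈ B} = 0 ↔
      ∀ᵐ x ∂m, condDistrib φ p m (p x) (Prod.mk (p x) ⁻¹' B) = 0 := by
  rw [measure_prodMk_mem_eq_lintegral_condDistrib hφ hp hB,
    lintegral_eq_zero_iff (by exact (Kernel.measurable_kernel_prodMk_left hB).comp hp)]
  rfl

/-- A coordinate which agrees with a function of the base is almost surely an atom. -/
theorem ae_mem_atomSet_of_eq (hφ : Measurable φ) (hp : Measurable p) {h : Z → ℝ}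
    (hh : Measurable h) :
    ∀ᵐ x ∂m, φ x = h (p x) → (p x, φ x) ∈ atomSet (condDistrib φ p m) := by
  have hB : MeasurableSet ({q : Z × ℝ | q.2 = h q.1} \ atomSet (condDistrib φ p m)) :=
    (measurableSet_eq_fun measurable_snd (hh.comp measurable_fst)).diff (measurableSet_atomSet _)
  -- Each fibre of the graph minus the atoms is empty or lies in one point of zero mass.
  have h0 := (measure_prodMk_mem_eq_zero_iff (m := m) hφ hp hB).2 <| .of_forall fun x => by
    by_cases hx : condDistrib φ p m (p x) {h (p x)} = 0
    · exact measure_mono_null (by rintro t ⟨ht, -⟩; exact ht) hx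
    · convert measure_empty
      · ext t
        simp only [mem_preimage, mem_sdiff, mem_ofPred_eq, atomSet, mem_empty_iff_false, iff_false,
          not_and, not_not]
        rintro rfl
        exact hx
      · infer_instance
  filter_upwards [measure_eq_zero_iff_ae_notMem.1 h0] with x hx hx'
  by_contra hc
  exact hx ⟨hx', hc⟩

end CondDistrib

/-! ### Functions of the Lebesgue coordinate. -/

section Coordinate

variable {X : Type*} [MeasurableSpace X] {m : Measure X} [m.IsComplete] {φ : X → ℝ}

/-- Compose `ψ` with an inverse of `φ` on the conull set: preimages are, mod 0, images of measurable
sets, so the composite is null measurable and has a Borel version. -/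
theorem IsLebesgueCoordinate.exists_ae_eq_comp [IsFiniteMeasure m] (hφ : IsLebesgueCoordinate m φ)
    {ψ : X → ℝ} (hψ : Measurable ψ) : ∃ T : ℝ → ℝ, Measurable T ∧ ∀ᵐ x ∂m, ψ x = T (φ x) := by
  obtain ⟨X₀, h0, hinj, himg⟩ := hφ.exists_conull
  rcases isEmpty_or_nonempty X with hX | hX
  · exact ⟨id, measurable_id, .of_forall fun x => isEmptyElim x⟩
  have hX₀ : MeasurableSet X₀ := by
    simpa using (measurableSet_of_null h0).compl
  let S := Function.invFunOn φ X₀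
  have hS : ∀ x ∈ X₀, S (φ x) = x := fun x hx => hinj.leftInvOn_invFunOn hx
  have hfull : m.map φ (φ '' X₀)ᶜ = 0 := by
    rw [Measure.map_apply₀ hφ.measurable.aemeasurable (himg X₀ subset_rfl hX₀).compl]
    exact measure_mono_null (fun x hx hx' => hx ⟨x, hx', rfl⟩) h0
  have hT : NullMeasurable (ψ ∘ S) (m.map φ) := by
    intro B hB
    refine NullMeasurableSet.congr (himg (X₀ ∩ ψ ⁻¹' B) inter_subset_left (hX₀.inter (hψ hB))) ?_
    filter_upwards [measure_eq_zero_iff_ae_notMem.1 hfull] with t ht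
    rw [notMem_compl_iff] at ht
    obtain ⟨x, hx, rfl⟩ := ht
    refine propext ⟨?_, fun h => ⟨x, ⟨hx, ?_⟩, rfl⟩⟩
    · rintro ⟨y, ⟨hy, hyB⟩, hyx⟩
      rw [hinj hy hx hyx] at hyB
      change ψ (S (φ x)) ∈ B
      rwa [hS x hx]
    · change ψ (S (φ x)) ∈ B at h
      rwa [hS x hx] at h
  have hT' : AEMeasurable (ψ ∘ S) (m.map φ) := hT.aemeasurable
  refine ⟨hT'.mk _, hT'.measurable_mk, ?_⟩
  filter_upwards [ae_of_ae_map hφ.measurable.aemeasurable hT'.ae_eq_mk,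
    measure_eq_zero_iff_ae_notMem.1 h0] with x hx hx0
  rw [← hx]
  simp [hS x (by simpa using hx0)]

end Coordinate

end HopfDecomposition

/-! ### The invariant factor and the Hopf decomposition. -/

namespace HopfDecomposition

/-- A measurable map `p : X → Z` whose fibration is that of the invariant sets: the preimages of
the measurable sets of `Z` are exactly the measurable `G`-invariant sets of `X`. -/
structure IsInvariantFactor (G : Type*) {X Z : Type*} [Group G] [MulAction G X]
    [MeasurableSpace X] [MeasurableSpace Z] (p : X → Z) : Prop where
  measurable : Measurable p
  smul_mem_iff : ∀ {T : Set Z}, MeasurableSet T → ∀ (g : G) (x : X), p (g • x) ∈ T ↔ p x ∈ T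
  exists_preimage : ∀ {S : Set X}, MeasurableSet S → (∀ (g : G) (x : X), g • x ∈ S ↔ x ∈ S) →
    ∃ T, MeasurableSet T ∧ p ⁻¹' T = S

theorem measurableSet_invariantSets_iff {G X : Type*} [Group G] [MulAction G X]
    [mX : MeasurableSpace X] {S : Set X} :
    MeasurableSet[invariantSets G X] S ↔
      MeasurableSet S ∧ ∀ (g : G) (x : X), g • x ∈ S ↔ x ∈ S := by
  simp only [MeasurableSpace.measurableSet_iInf,
    MeasurableSpace.measurableSet_invariants, forall_and, Set.ext_iff, mem_preimage, forall_const]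

/-- The factor underlying `ergodicComponent`. A general `Z` elsewhere keeps the two σ-algebras on
`X` apart. -/
theorem isInvariantFactor_id (G X : Type*) [Group G] [MulAction G X] [mX : MeasurableSpace X] :
    @IsInvariantFactor G X X _ _ mX (invariantSets G X) id :=
  @IsInvariantFactor.mk G X X _ _ mX (invariantSets G X) id
    (fun _ hS => (measurableSet_invariantSets_iff.1 hS).1)
    (fun hT => (measurableSet_invariantSets_iff.1 hT).2)
    (fun {S} hS h => ⟨S, measurableSet_invariantSets_iff.2 ⟨hS, h⟩, rfl⟩)

variable {G X Z : Type*} [Group G] [MulAction G X] [MeasurableSpace X] [MeasurableSpace Z]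
  {m : Measure X} {φ : X → ℝ} {p : X → Z}

namespace IsInvariantFactor

theorem apply_smul (hp : IsInvariantFactor G p) {h : Z → ℝ} (hh : Measurable h) (g : G) (x : X) :
    h (p (g • x)) = h (p x) :=
  (hp.smul_mem_iff (hh (measurableSet_singleton (h (p x)))) g x).2 rfl

theorem exists_eq_comp (hp : IsInvariantFactor G p) {f : X → ℝ} (hf : Measurable f)
    (hinv : ∀ (g : G) (x : X), f (g • x) = f x) : ∃ h : Z → ℝ, Measurable h ∧ f = h ∘ p :=
  Measurable.exists_eq_measurable_comp fun B hB => by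
    exact hp.exists_preimage (hf hB) fun g x => by simp [hinv]

theorem isInvariantMeasurable_preimage (hp : IsInvariantFactor G p) {T : Set Z}
    (hT : MeasurableSet T) : IsInvariantMeasurable G (p ⁻¹' T) := by
  refine ⟨hp.measurable hT, fun g => ?_⟩
  ext x
  rw [mem_smul_set_iff_inv_smul_mem]
  exact hp.smul_mem_iff hT _ x

variable [IsFiniteMeasure m]

/-- The set of points which are atoms of their ergodic component is invariant mod 0. -/
theorem ae_mem_atomSet_smul [m.IsComplete] (hp : IsInvariantFactor G p)
    (hφ : IsLebesgueCoordinate m φ) {g : G}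
    (hg : Measure.QuasiMeasurePreserving (fun x : X => g • x) m m) :
    ∀ᵐ x ∂m, (p x, φ x) ∈ atomSet (condDistrib φ p m) →
      (p (g • x), φ (g • x)) ∈ atomSet (condDistrib φ p m) := by
  obtain ⟨T, hT, hφT⟩ := hφ.exists_ae_eq_comp (hφ.measurable.comp hg.measurable)
  have hq (q : ℚ) : Measurable (quantile (condDistrib φ p m) (Real.toNNReal q)) :=
    measurable_quantile _ _
  -- An atom is `φ x = quantile q (p x)`, so `φ (g • x) = T (φ x)` lies on the graph of `T ∘
  -- quantile q`, by invariance of `p`.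
  have h (q : ℚ) := hg.ae (ae_mem_atomSet_of_eq (m := m) hφ.measurable hp.measurable
    (hT.comp (hq q)))
  filter_upwards [hφT, ae_all_iff.2 h] with x hx hx' hatom
  obtain ⟨q, hqx⟩ := exists_quantile_eq _ hatom
  refine hx' q ?_
  simp only [Function.comp_apply] at hx ⊢
  rw [hp.apply_smul (hq q), hqx, hx]

theorem ae_isPurelyNonAtomic_or_isPurelyAtomic [Countable G] [m.IsComplete]
    (hp : IsInvariantFactor G p) (hφ : IsLebesgueCoordinate m φ)
    (hG : ∀ g : G, Measure.QuasiMeasurePreserving (fun x : X => g • x) m m) :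
    ∀ᵐ x ∂m, IsPurelyNonAtomic (condDistrib φ p m (p x)) ∨
      IsPurelyAtomic (condDistrib φ p m (p x)) := by
  set κ := condDistrib φ p m
  have hA := measurableSet_atomSet κ
  have hpφ : Measurable fun x => (p x, φ x) := hp.measurable.prodMk hφ.measurable
  -- Requiring the whole orbit to consist of atoms gives a strictly invariant set, equal mod 0 to
  -- the set of atoms.
  obtain ⟨T, hT, hTA⟩ := hp.exists_preimage (S := ⋂ g : G, {x | (p (g • x), φ (g • x)) ∈ atomSet κ})
    (MeasurableSet.iInter fun g => (hpφ.comp (hG g).measurable) hA) (fun g x => by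
      simp only [mem_iInter, mem_ofPred_eq, smul_smul]
      refine ⟨fun h k => ?_, fun h k => h _⟩
      simpa using h (k * g⁻¹))
  have hTiff (x : X) : p x ∈ T ↔ ∀ g : G, (p (g • x), φ (g • x)) ∈ atomSet κ := by
    rw [← mem_preimage, hTA]; simp
  have h1 : m {x | (p x, φ x) ∈ T ×ˢ univ \ atomSet κ} = 0 := by
    convert measure_empty (μ := m)
    ext x
    simp only [mem_ofPred_eq, mem_sdiff, mem_prod, mem_univ, and_true, mem_empty_iff_false,
      iff_false, not_and, not_not, hTiff]
    intro h
    simpa using h 1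
  have h2 : m {x | (p x, φ x) ∈ Tᶜ ×ˢ univ ∩ atomSet κ} = 0 := by
    rw [measure_eq_zero_iff_ae_notMem]
    filter_upwards [ae_all_iff.2 fun g => hp.ae_mem_atomSet_smul hφ (hG g)] with x hx hx'
    exact hx'.1.1 ((hTiff x).2 fun g => hx g hx'.2)
  rw [measure_prodMk_mem_eq_zero_iff hφ.measurable hp.measurable
    ((hT.prod .univ).diff hA)] at h1
  rw [measure_prodMk_mem_eq_zero_iff hφ.measurable hp.measurable
    ((hT.compl.prod .univ).inter hA)] at h2
  filter_upwards [h1, h2] with x h1 h2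
  by_cases hx : p x ∈ T
  · right
    rw [isPurelyAtomic_iff]
    convert h1 using 2
    ext t; simp [hx]
  · left
    rw [isPurelyNonAtomic_iff]
    convert h2 using 2
    ext t; simp [hx]

/-- A measurable set of points which never return to it meets the continual part in a null set. -/
theorem measure_eq_zero_of_nonreturning [Countable G] (hp : IsInvariantFactor G p)
    (hφ : Measurable φ) (hG : ∀ g : G, Measurable (fun x : X => g • x)) {W : Set X}
    (hW : MeasurableSet W) (hret : ∀ x ∈ W, ∀ g : G, g ≠ 1 → g • x ∉ W)
    (hna : ∀ x ∈ W, IsPurelyNonAtomic (condDistrib φ p m (p x))) : m W = 0 := by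
  classical
  -- The coordinate of the only orbit point in `W`; the default 0 keeps `f` invariant on orbits
  -- missing `W`.
  let f : X → ℝ := fun x => if h : ∃ g : G, g • x ∈ W then φ (h.choose • x) else 0
  have huniq {x : X} {g k : G} (hg : g • x ∈ W) (hk : k • x ∈ W) : g = k := by
    by_contra hne
    refine hret _ hg (k * g⁻¹) (fun h => hne (mul_inv_eq_one.1 h).symm) ?_
    simpa [smul_smul] using hk
  have hf_mem {x : X} {g : G} (hg : g • x ∈ W) : f x = φ (g • x) := by
    have h : ∃ g : G, g • x ∈ W := ⟨g, hg⟩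
    simp only [f, dif_pos h]
    rw [huniq h.choose_spec hg]
  have hf_notMem {x : X} (h : ¬ ∃ g : G, g • x ∈ W) : f x = 0 := dif_neg h
  have hfinv (k : G) (x : X) : f (k • x) = f x := by
    by_cases h : ∃ g : G, g • x ∈ W
    · obtain ⟨g, hg⟩ := h
      have hg' : (g * k⁻¹) • k • x ∈ W := by simpa [smul_smul] using hg
      rw [hf_mem hg, hf_mem hg']
      simp [smul_smul]
    · rw [hf_notMem h, hf_notMem]
      rintro ⟨g, hg⟩
      exact h ⟨g * k, by rwa [mul_smul]⟩
  have hfm : Measurable f := by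
    intro B hB
    have hfB : f ⁻¹' B = (⋃ g : G, (fun x => g • x) ⁻¹' (W ∩ φ ⁻¹' B)) ∪
        ((⋃ g : G, (fun x => g • x) ⁻¹' W)ᶜ ∩ {_x | (0 : ℝ) ∈ B}) := by
      ext x
      by_cases h : ∃ g : G, g • x ∈ W
      · obtain ⟨g, hg⟩ := h
        have hx : x ∈ ⋃ g : G, (fun x => g • x) ⁻¹' W := mem_iUnion.2 ⟨g, hg⟩
        simp only [mem_preimage, hf_mem hg, mem_union, mem_iUnion, mem_inter_iff, mem_compl_iff,
          hx, not_true_eq_false, false_and, or_false]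
        exact ⟨fun hB => ⟨g, hg, hB⟩, fun ⟨k, hk, hB⟩ => huniq hg hk ▸ hB⟩
      · have h' : ∀ g : G, g • x ∉ W := not_exists.1 h
        simp [hf_notMem h, h']
    rw [hfB]
    exact (MeasurableSet.iUnion fun g => hG g (hW.inter (hφ hB))).union
      ((MeasurableSet.iUnion fun g => hG g hW).compl.inter (.const _))
  obtain ⟨h, hh, hfh⟩ := hp.exists_eq_comp hfm hfinv
  have hB : MeasurableSet {q : Z × ℝ | q.2 = h q.1 ∧ IsPurelyNonAtomic (condDistrib φ p m q.1)} :=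
    (measurableSet_eq_fun measurable_snd (hh.comp measurable_fst)).inter
      (measurable_fst (measurableSet_isPurelyNonAtomic _))
  have h0 := (measure_prodMk_mem_eq_zero_iff (m := m) hφ hp.measurable hB).2 <| .of_forall
    fun x => by
      by_cases hx : IsPurelyNonAtomic (condDistrib φ p m (p x))
      · exact measure_mono_null (by rintro t ⟨ht, -⟩; exact ht) (hx (h (p x)))
      · exact measure_mono_null (by rintro t ⟨-, ht⟩; exact hx ht) measure_empty
  have hsub : ∀ x ∈ W, φ x = h (p x) := fun x hx => by
    have h1 : (1 : G) • x ∈ W := by simpa using hx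
    simpa [hfh] using (hf_mem h1).symm
  exact measure_mono_null (t := {x | (p x, φ x) ∈ {q : Z × ℝ | q.2 = h q.1 ∧ _}})
    (fun x hx => ⟨hsub x hx, hna x hx⟩) h0

theorem isConservativeOn [Countable G] (hp : IsInvariantFactor G p)
    (hφ : Measurable φ) (hG : ∀ g : G, Measurable (fun x : X => g • x)) {Y : Set X}
    (hY : ∀ x ∈ Y, MulAction.stabilizer G x = ⊥ →
      IsPurelyNonAtomic (condDistrib φ p m (p x))) : IsConservativeOn G m Y := by
  refine fun A hAY hA => ⟨hA, ?_⟩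
  have hWm : MeasurableSet {x | x ∈ A ∧ ∀ g : G, g ≠ 1 → g • x ∉ A} := by
    have : {x | x ∈ A ∧ ∀ g : G, g ≠ 1 → g • x ∉ A} =
        A ∩ ⋂ g : {g : G // g ≠ 1}, ((fun x => (g : G) • x) ⁻¹' A)ᶜ := by
      ext x; simp
    rw [this]
    exact hA.inter (.iInter fun g => (hG g hA).compl)
  have h0 := hp.measure_eq_zero_of_nonreturning (m := m) hφ hG hWm
    (fun x hx g hg h => hx.2 g hg h.1) (fun x hx => hY x (hAY hx.1) <| by
      rw [eq_bot_iff]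
      intro g hg
      by_contra hne
      exact hx.2 g hne (by rw [MulAction.mem_stabilizer_iff.1 hg]; exact hx.1))
  filter_upwards [measure_eq_zero_iff_ae_notMem.1 h0] with x hx hxA
  by_contra! hc
  exact hx ⟨hxA, hc⟩

theorem isCompletelyDissipativeOn [Countable G] [m.IsComplete] (hp : IsInvariantFactor G p)
    (hφ : IsLebesgueCoordinate m φ)
    (hG : ∀ g : G, Measure.QuasiMeasurePreserving (fun x : X => g • x) m m) {Y : Set X}
    (hY : IsInvariantMeasurable G Y) (hfree : ∀ x ∈ Y, MulAction.stabilizer G x = ⊥)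
    (hat : ∀ x ∈ Y, ¬ IsPurelyNonAtomic (condDistrib φ p m (p x))) :
    IsCompletelyDissipativeOn G m Y := by
  obtain ⟨f, hf, hfat⟩ := exists_measurable_atom (condDistrib φ p m)
  obtain ⟨X₀, h0, hinj, -⟩ := hφ.exists_conull
  have hX₀ : MeasurableSet X₀ := by simpa using (measurableSet_of_null h0).compl
  have hYinv (g : G) (x : X) : g • x ∈ Y ↔ x ∈ Y := by
    conv_lhs => rw [← hY.2 g, smul_mem_smul_set_iff]
  let A : Set X := Y ∩ (X₀ ∩ {x | φ x = f (p x)})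
  have hA : MeasurableSet A := hY.1.inter
    (hX₀.inter (measurableSet_eq_fun hφ.measurable (hf.comp hp.measurable)))
  have hsat : MeasurableSet (⋃ g : G, g • A) := by
    refine .iUnion fun g => ?_
    have : g • A = (fun x => g⁻¹ • x) ⁻¹' A := by
      ext x; rw [mem_smul_set_iff_inv_smul_mem]; rfl
    rw [this]
    exact (hG g⁻¹).measurable hA
  have hsatY : (⋃ g : G, g • A) ⊆ Y := iUnion_subset fun g => by
    rw [← hY.2 g]; exact smul_set_mono inter_subset_left
  refine ⟨A, inter_subset_left, ⟨hA, fun g k hgk => ?_⟩, ?_⟩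
  · refine Set.disjoint_left.2 fun x hg hk => ?_
    rw [mem_smul_set_iff_inv_smul_mem] at hg hk
    have hxY : x ∈ Y := (hYinv _ _).1 hg.1
    have heq : g⁻¹ • x = k⁻¹ • x := by
      refine hinj hg.2.1 hk.2.1 ?_
      rw [show φ (g⁻¹ • x) = _ from hg.2.2, show φ (k⁻¹ • x) = _ from hk.2.2,
        hp.apply_smul hf, hp.apply_smul hf]
    have hst : k * g⁻¹ ∈ MulAction.stabilizer G x := by
      rw [MulAction.mem_stabilizer_iff, mul_smul, heq, smul_inv_smul]
    rw [hfree x hxY, Subgroup.mem_bot, mul_inv_eq_one] at hst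
    exact hgk hst.symm
  -- The uncovered part of `Y` is invariant, and the graph of `f` over it avoids `X₀`, so is null;
  -- but its fibres are atoms of positive mass.
  · obtain ⟨T, hT, hTB⟩ := hp.exists_preimage (hY.1.diff hsat) (G := G) (fun g x => by
      rw [mem_sdiff, mem_sdiff, hYinv]
      refine and_congr_right fun _ => not_congr ?_
      simp only [mem_iUnion, mem_smul_set_iff_inv_smul_mem, smul_smul]
      refine ⟨fun ⟨k, hk⟩ => ⟨g⁻¹ * k, by simpa using hk⟩,
        fun ⟨k, hk⟩ => ⟨g * k, by simpa [mul_assoc] using hk⟩⟩)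
    have hB : MeasurableSet {q : Z × ℝ | q.2 = f q.1 ∧ q.1 ∈ T} :=
      (measurableSet_eq_fun measurable_snd (hf.comp measurable_fst)).inter (measurable_fst hT)
    have h1 : m {x | (p x, φ x) ∈ {q : Z × ℝ | q.2 = f q.1 ∧ q.1 ∈ T}} = 0 := by
      refine measure_mono_null (t := X₀ᶜ) (fun x hx hx0 => ?_) h0
      have hxT : x ∈ p ⁻¹' T := hx.2
      rw [hTB] at hxT
      exact hxT.2 (mem_iUnion.2 ⟨1, by rw [one_smul]; exact ⟨hxT.1, hx0, hx.1⟩⟩)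
    rw [measure_prodMk_mem_eq_zero_iff hφ.measurable hp.measurable hB] at h1
    filter_upwards [h1] with x hx
    refine propext ⟨fun h => hsatY h, fun h => ?_⟩
    by_contra hc
    have hxT : x ∈ p ⁻¹' T := by rw [hTB]; exact ⟨h, hc⟩
    refine hfat (p x) (hat x h) ?_
    convert hx using 2
    ext t
    simpa using fun _ => hxT

end IsInvariantFactor

/-- Injectivity of `φ` mod 0 turns `g • x = x` into an equality of real functions, and completeness
absorbs the null set. -/
theorem IsLebesgueCoordinate.measurableSet_stabilizer_eq_bot [Countable G] [m.IsComplete]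
    (hφ : IsLebesgueCoordinate m φ)
    (hG : ∀ g : G, Measure.QuasiMeasurePreserving (fun x : X => g • x) m m) :
    MeasurableSet {x : X | MulAction.stabilizer G x = ⊥} := by
  obtain ⟨X₀, h0, hinj, -⟩ := hφ.exists_conull
  have hX₀ : ∀ᵐ x ∂m, x ∈ X₀ := h0
  have hfix (g : G) : MeasurableSet {x : X | g • x = x} := by
    have h := measurableSet_eq_fun (hφ.measurable.comp (hG g).measurable) hφ.measurable
    refine (h.nullMeasurableSet.congr (μ := m) ?_).measurable_of_complete
    filter_upwards [hX₀, (hG g).ae hX₀] with x hx hgx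
    exact propext ⟨fun h => hinj hgx hx h, fun h => congrArg φ h⟩
  have : {x : X | MulAction.stabilizer G x = ⊥} =
      ⋂ g : {g : G // g ≠ 1}, {x : X | (g : G) • x = x}ᶜ := by
    ext x
    simp only [mem_ofPred_eq, Subgroup.eq_bot_iff_forall, MulAction.mem_stabilizer_iff, mem_iInter,
      mem_compl_iff, Subtype.forall]
    exact forall_congr' fun g => not_imp_not.symm.trans Iff.rfl
  rw [this]
  exact .iInter fun g => (hfix g).compl

theorem stabilizer_smul_eq_bot_iff {H Y : Type*} [Group H] [MulAction H Y] (g : H) (x : Y) :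
    MulAction.stabilizer H (g • x) = ⊥ ↔ MulAction.stabilizer H x = ⊥ := by
  rw [MulAction.stabilizer_smul_eq_stabilizer_map_conj,
    Subgroup.map_eq_bot_iff_of_injective _ (MulAut.conj g).injective]

end HopfDecomposition

open HopfDecomposition in
theorem mainTheorem3 {G X : Type*} [Group G] [Countable G] [MulAction G X] [MeasurableSpace X]
    (m : MeasureTheory.Measure X) [MeasureTheory.IsProbabilityMeasure m] [m.IsComplete]
    (φ : X → ℝ) (hφ : IsLebesgueCoordinate m φ)
    (hG : ∀ g : G, MeasureTheory.Measure.QuasiMeasurePreserving (fun x : X => g • x) m m) :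
    -- the parts are measurable and invariant
    IsInvariantMeasurable G (continualPart G m φ) ∧
    IsInvariantMeasurable G (discontinualPart G m φ) ∧
    IsInvariantMeasurable G (freeDiscontinualPart G m φ) ∧
    -- almost every point lies in exactly one of the continual and discontinual parts
    Disjoint (continualPart G m φ) (discontinualPart G m φ) ∧
    (∀ᵐ x ∂m, x ∈ continualPart G m φ ∪ discontinualPart G m φ) ∧
    -- the Hopf decomposition
    Disjoint
      (continualPart G m φ ∪ (discontinualPart G m φ \ freeDiscontinualPart G m φ))
      (freeDiscontinualPart G m φ) ∧
    (∀ᵐ x ∂m, x ∈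
      (continualPart G m φ ∪ (discontinualPart G m φ \ freeDiscontinualPart G m φ)) ∪
        freeDiscontinualPart G m φ) ∧
    IsConservativeOn G m
      (continualPart G m φ ∪ (discontinualPart G m φ \ freeDiscontinualPart G m φ)) ∧
    IsCompletelyDissipativeOn G m (freeDiscontinualPart G m φ) := by
  have hp := isInvariantFactor_id G X
  have hC : IsInvariantMeasurable G (continualPart G m φ) :=
    @IsInvariantFactor.isInvariantMeasurable_preimage G X X _ _ _ (invariantSets G X) id hp _
      (@measurableSet_isPurelyNonAtomic X (invariantSets G X) _ inferInstance)
  have hD : IsInvariantMeasurable G (discontinualPart G m φ) :=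
    @IsInvariantFactor.isInvariantMeasurable_preimage G X X _ _ _ (invariantSets G X) id hp _
      (@measurableSet_isPurelyAtomic X (invariantSets G X) _ inferInstance)
  have hF : IsInvariantMeasurable G (freeDiscontinualPart G m φ) := by
    refine ⟨hD.1.inter (hφ.measurableSet_stabilizer_eq_bot hG), fun g => ?_⟩
    ext x
    rw [mem_smul_set_iff_inv_smul_mem]
    refine and_congr ?_ (stabilizer_smul_eq_bot_iff _ _)
    rw [← mem_smul_set_iff_inv_smul_mem, hD.2 g]
  have hFD : freeDiscontinualPart G m φ ⊆ discontinualPart G m φ := fun x hx => hx.1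
  have hnot (x : X) (hx : x ∈ continualPart G m φ) : x ∉ discontinualPart G m φ := by
    have : IsProbabilityMeasure (ergodicComponent G m φ x) := by
      unfold ergodicComponent; infer_instance
    exact not_isPurelyAtomic_of_isPurelyNonAtomic hx
  have hCD : ∀ᵐ x ∂m, x ∈ continualPart G m φ ∪ discontinualPart G m φ :=
    @IsInvariantFactor.ae_isPurelyNonAtomic_or_isPurelyAtomic G X X _ _ _ (invariantSets G X)
      m φ id _ _ _ hp hφ hG
  refine ⟨hC, hD, hF, Set.disjoint_left.2 hnot, hCD, ?_, ?_, ?_, ?_⟩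
  · rw [Set.disjoint_left]
    rintro x (hx | hx) hxF
    · exact hnot x hx (hFD hxF)
    · exact hx.2 hxF
  · filter_upwards [hCD] with x hx
    by_cases hxF : x ∈ freeDiscontinualPart G m φ
    · exact Or.inr hxF
    · exact Or.inl (hx.imp_right fun h => ⟨h, hxF⟩)
  · refine @IsInvariantFactor.isConservativeOn G X X _ _ _ (invariantSets G X) m φ id _ _ hp
      hφ.measurable (fun g => (hG g).measurable) _ ?_
    rintro x (hx | hx) hst
    · exact hx
    · exact absurd ⟨hx.1, hst⟩ hx.2
  · exact @IsInvariantFactor.isCompletelyDissipativeOn G X X _ _ _ (invariantSets G X) m φ id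
      _ _ _ hp hφ hG _ hF (fun x hx => hx.2) (fun x hx h => hnot x h hx.1)
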